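/- Let $R$ be an associative ring with unit; modules are right $R$-modules. For a class $\mathcal C$ of modules put $\mathcal C^\perp=\{M \mid \operatorname{Ext}^1_R(C,M)=0 \text{ for all } C\in\mathcal C\}$ and ${}^\perp\mathcal C=\{M \mid \operatorname{Ext}^1_R(M,C)=0 \text{ for all } C\in\mathcal C\}$. A pair $(\mathcal A,\mathcal B)$ of classes of modules is a cotorsion pair if $\mathcal A={}^\perp\mathcal B$ and $\mathcal B=\mathcal A^\perp$. For a class $\mathcal S$ of modules, let $\operatorname{Filt}(\mathcal S)$ be the class of all modules $M$ that possess, for some ordinal $\sigma$, an increasing chain of submodules $(M_\alpha\mid\alpha\le\sigma)$ with $M_0=0$, $M_\sigma=M$, $M_\alpha=\bigcup_{\beta<\alpha}M_\beta$ for every limit ordinal $\alpha\le\sigma$, and $M_{\alpha+1}/M_\alpha$ isomorphic to an element of $\mathcal S$ for every $\alpha<\sigma$; let $\operatorname{sFilt}(\mathcal S)$ be the class of all modules isomorphic to a direct summand of a module in $\operatorname{Filt}(\mathcal S)$. **Lemma.** Let $(\mathcal A,\mathcal B)$ be a cotorsion pair in the category of right $R$-modules. Then the following conditions are equivalent: 1.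 $(\mathcal A,\mathcal B)$ is generated by a set, i.e. there is a set (not a proper class) $\mathcal S$ of modules with $\mathcal B=\mathcal S^\perp$. 2. There is a set $\mathcal S\subseteq\mathcal A$ with $\mathcal A=\operatorname{sFilt}(\mathcal S)$. 3. $\mathcal A$ is deconstructible, i.e. there is a set $\mathcal S\subseteq\mathcal A$ with $\mathcal A=\operatorname{Filt}(\mathcal S)$. 4. There is a monomorphism $f:Q\to P$ of modules with $P$ projective such that $\mathcal B$ is the factorization class of $f$, i.e. $\mathcal B=\{M \mid \operatorname{Hom}_R(f,M):\operatorname{Hom}_R(P,M)\to\operatorname{Hom}_R(Q,M) \text{ is surjective}\}$. -/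

import Mathlib

universe u

/-- The right orthogonal class `𝒞^⊥`: all modules `M` with `Ext¹(C, M) = 0` for all `C ∈ 𝒞`. -/
def rightPerp {R : Type u} [Ring R] (𝒞 : Set (ModuleCat.{u} R)) : Set (ModuleCat.{u} R) :=
  {M | ∀ C ∈ 𝒞, Subsingleton (CategoryTheory.Abelian.Ext.{u} C M 1)}

/-- The left orthogonal class `^⊥𝒞`: all modules `M` with `Ext¹(M, C) = 0` for all `C ∈ 𝒞`. -/
def leftPerp {R : Type u} [Ring R] (𝒞 : Set (ModuleCat.{u} R)) : Set (ModuleCat.{u} R) :=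
  {M | ∀ C ∈ 𝒞, Subsingleton (CategoryTheory.Abelian.Ext.{u} M C 1)}

/-- `(𝒜, ℬ)` is a cotorsion pair: `𝒜 = ^⊥ℬ` and `ℬ = 𝒜^⊥`. -/
structure IsCotorsionPair {R : Type u} [Ring R] (𝒜 ℬ : Set (ModuleCat.{u} R)) : Prop where
  left_eq : 𝒜 = leftPerp ℬ
  right_eq : ℬ = rightPerp 𝒜

/-- The class `Filt(𝒮)` of all `𝒮`-filtered modules: modules `M` which admit a chain of
submodules `(F α ∣ α ≤ σ)`, for some ordinal `σ`, that is increasing, continuous, starts at `0`,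
ends at `M`, and whose consecutive factors `F (α + 1) / F α` (for `α < σ`) are isomorphic to
elements of `𝒮`. -/
def Filt {R : Type u} [Ring R] (𝒮 : Set (ModuleCat.{u} R)) : Set (ModuleCat.{u} R) :=
  {M | ∃ (σ : Ordinal.{u}) (F : Ordinal.{u} → Submodule R M),
    F 0 = ⊥ ∧ F σ = ⊤ ∧
    (∀ α β, α ≤ β → β ≤ σ → F α ≤ F β) ∧
    (∀ α, α ≤ σ → Order.IsSuccLimit α → F α = ⨆ β : Set.Iio α, F β) ∧
    ∀ α, α < σ → ∃ S ∈ 𝒮,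
      Nonempty ((F (Order.succ α) ⧸ (F α).submoduleOf (F (Order.succ α))) ≃ₗ[R] S)}

/-- The class `sFilt(𝒮)` of all modules isomorphic to a direct summand of an `𝒮`-filtered
module. -/
def sFilt {R : Type u} [Ring R] (𝒮 : Set (ModuleCat.{u} R)) : Set (ModuleCat.{u} R) :=
  {M | ∃ X ∈ Filt 𝒮, ∃ P P' : Submodule R X, IsCompl P P' ∧ Nonempty (M ≃ₗ[R] P)}

/-- `𝒞` is deconstructible: `𝒞 = Filt(𝒮)` for some subset (not a proper class) `𝒮 ⊆ 𝒞`.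
A class of modules in `Type u` is a set when it is `u`-small. -/
def IsDeconstructible {R : Type u} [Ring R] (𝒞 : Set (ModuleCat.{u} R)) : Prop :=
  ∃ 𝒮 : Set (ModuleCat.{u} R), Small.{u} 𝒮 ∧ 𝒮 ⊆ 𝒞 ∧ 𝒞 = Filt 𝒮

/-- The factorization class of `f : Q ⟶ P`: all modules `M` such that
`Hom(f, M) : Hom(P, M) → Hom(Q, M)` is surjective. -/
def factorizationClass {R : Type u} [Ring R] {Q P : ModuleCat.{u} R} (f : Q ⟶ P) :
    Set (ModuleCat.{u} R) :=
  {M | Function.Surjective fun g : P ⟶ M => CategoryTheory.CategoryStruct.comp f g}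

open CategoryTheory
open CategoryTheory.Abelian (Ext)
open scoped DirectSum

/-! Vanishing of `Ext¹(C, B)` is an extension property: if `C = F/K` with `F` projective, it says
that every map `K → B` extends to `F`. Hence the right orthogonal of a single module is the
factorization class of such an inclusion, and the right orthogonal of a set is that of a direct sum
of them. This gives 1 → 4. Eklof's lemma (a module filtered by modules left orthogonal to `B` is
left orthogonal to `B`) gives 3 → 2 and 2 → 1, since left orthogonality also passes to direct
summands.

The substance is 4 → 3. Replace `f : Q → P` by `g = (f, 0) : Q → P × R`. The small object argument
for `g`, applied to `0 → M`, gives `p : X → M` with the right lifting property against `g`, where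
`X` is built by attaching copies of `g`. Lifting makes `p` surjective (thanks to the summand `R`)
and puts `ker p` in `ℬ`. If `M ∈ 𝒜`, then `p` splits, so `M` is a summand of a module filtered by
copies of `coker g`.

A summand of a filtered module must then itself be filtered, at the cost of larger factors. As in
Kaplansky's theorem, this needs many small submodules stable under the idempotent of the splitting.
Hill's lemma supplies them: it expands the one filtration of `X` into a family of submodules closed
under arbitrary sums, all of whose subfactors lie in `𝒜`. The images of the stable members yield a
filtration of `M` whose factors lie in `𝒜` and have at most `κ = max(ℵ₀, |P × R|)` elements; up to
isomorphism these form a set.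

Filtrations are handled through step families, families of submodules with a successor operation and
unions of chains, so that most arguments avoid ordinals. -/

namespace CotorsionPair

variable {R : Type u} [Ring R]

/-- `Ext¹(C, B) = 0`. -/
abbrev ExtVanishes (C : Type u) [AddCommGroup C] [Module R C] (B : ModuleCat.{u} R) : Prop :=
  Subsingleton (Ext.{u} (ModuleCat.of R C) B 1)

/-! ### Vanishing of Ext¹ as an extension property. -/

section Ext

variable {V X C D : Type u} [AddCommGroup V] [Module R V] [AddCommGroup X] [Module R X]
  [AddCommGroup C] [Module R C] [AddCommGroup D] [Module R D] {B : ModuleCat.{u} R}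

theorem ExtVanishes.of_retract (h : ExtVanishes D B) (i : C →ₗ[R] D) (r : D →ₗ[R] C)
    (hri : ∀ x, r (i x) = x) : ExtVanishes C B := by
  refine subsingleton_of_forall_eq 0 fun x ↦ ?_
  have hid : ModuleCat.ofHom i ≫ ModuleCat.ofHom r = 𝟙 (ModuleCat.of R C) := by
    ext y
    exact hri y
  have h0 : (Ext.mk₀ (ModuleCat.ofHom r)).comp x (zero_add 1) = 0 := Subsingleton.elim _ _
  calc x = (Ext.mk₀ (𝟙 (ModuleCat.of R C))).comp x (zero_add 1) := by simp
    _ = (Ext.mk₀ (ModuleCat.ofHom i)).comp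
          ((Ext.mk₀ (ModuleCat.ofHom r)).comp x (zero_add 1)) (zero_add 1) := by
        rw [Ext.mk₀_comp_mk₀_assoc, hid]
    _ = 0 := by rw [h0, Ext.comp_zero]

theorem ExtVanishes.of_equiv (h : ExtVanishes D B) (e : C ≃ₗ[R] D) : ExtVanishes C B :=
  h.of_retract e.toLinearMap e.symm.toLinearMap (by simp)

theorem shortExact_of_linearMap {φ : V →ₗ[R] X} {ψ : X →ₗ[R] C} (hφ : Function.Injective φ)
    (hψ : Function.Surjective ψ) (hex : Function.Exact φ ψ) :
    (ShortComplex.mk (ModuleCat.ofHom φ) (ModuleCat.ofHom ψ)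
      (by ext x; exact hex.apply_apply_eq_zero x)).ShortExact where
  exact := (ShortComplex.ShortExact.moduleCat_exact_iff_function_exact _).mpr hex
  mono_f := (ModuleCat.mono_iff_injective _).2 hφ
  epi_g := (ModuleCat.epi_iff_surjective _).2 hψ

/-- The obstruction to extending `g` along `φ` is its image under the connecting map, which lies in
`Ext¹(C, B)`. -/
theorem ExtVanishes.exists_extension (h : ExtVanishes C B) {φ : V →ₗ[R] X} {ψ : X →ₗ[R] C}
    (hφ : Function.Injective φ) (hψ : Function.Surjective ψ) (hex : Function.Exact φ ψ)
    (g : V →ₗ[R] B) : ∃ k : X →ₗ[R] B, k ∘ₗ φ = g := by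
  have hS := shortExact_of_linearMap hφ hψ hex
  obtain ⟨x, hx⟩ := Ext.contravariant_sequence_exact₁ hS B (Ext.mk₀ (ModuleCat.ofHom g))
    (add_zero 1) (Subsingleton.elim (h := h) _ _)
  obtain ⟨k, rfl⟩ := (Ext.mk₀_bijective _ _).2 x
  rw [Ext.mk₀_comp_mk₀] at hx
  have hk := (Ext.mk₀_bijective _ _).1 hx
  exact ⟨k.hom, LinearMap.ext fun v ↦ LinearMap.congr_fun (congrArg ModuleCat.Hom.hom hk) v⟩

/-- As `X` is projective, every class in `Ext¹(C, B)` is the connecting image of some `V → B`; a map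
that extends to `X` has connecting image zero. -/
theorem ExtVanishes.of_exists_extension [Module.Projective R X] {φ : V →ₗ[R] X} {ψ : X →ₗ[R] C}
    (hφ : Function.Injective φ) (hψ : Function.Surjective ψ) (hex : Function.Exact φ ψ)
    (h : ∀ g : V →ₗ[R] B, ∃ k : X →ₗ[R] B, k ∘ₗ φ = g) : ExtVanishes C B := by
  have hS := shortExact_of_linearMap hφ hψ hex
  have hproj : Projective (ModuleCat.of R X) := (IsProjective.iff_projective X).1 inferInstance
  refine subsingleton_of_forall_eq 0 fun x ↦ ?_
  obtain ⟨y, hy⟩ := Ext.contravariant_sequence_exact₃ hS B x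
    (Ext.eq_zero_of_projective (P := ModuleCat.of R X) _) (add_zero 1)
  obtain ⟨g, rfl⟩ := (Ext.mk₀_bijective _ _).2 y
  obtain ⟨k, hk⟩ := h g.hom
  have hg : g = ModuleCat.ofHom φ ≫ ModuleCat.ofHom k := by
    ext v
    exact (LinearMap.congr_fun hk v).symm
  rw [← hy, hg, ← Ext.mk₀_comp_mk₀]
  exact hS.extClass_comp_assoc _

end Ext

/-! ### Step families, Eklof's lemma and filtrations. -/

/-- A family of submodules of `W` which is closed under unions of nonempty chains and in which
every proper member `N` has a strictly larger member `N'` with `p N N'`. -/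
structure IsStepFamily {W : Type u} [AddCommGroup W] [Module R W] (𝓗 : Set (Submodule R W))
    (p : Submodule R W → Submodule R W → Prop) : Prop where
  sSup_mem : ∀ c ⊆ 𝓗, c.Nonempty → IsChain (· ≤ ·) c → sSup c ∈ 𝓗
  step : ∀ N ∈ 𝓗, N ≠ ⊤ → ∃ N' ∈ 𝓗, N < N' ∧ p N N'

/-- **Eklof's lemma** for step families. -/
theorem IsStepFamily.extVanishes {W : Type u} [AddCommGroup W] [Module R W] {B : ModuleCat.{u} R}
    {𝓗 : Set (Submodule R W)}
    (h𝓗 : IsStepFamily 𝓗 fun N N' ↦ ExtVanishes (N' ⧸ N.submoduleOf N') B)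
    {Y : Submodule R W} (hY : Y ∈ 𝓗) : ExtVanishes (W ⧸ Y) B := by
  let π : (W →₀ R) →ₗ[R] W := Finsupp.linearCombination R id
  have hπ : Function.Surjective π := Finsupp.linearCombination_id_surjective R W
  refine ExtVanishes.of_exists_extension (V := Y.comap π) (X := W →₀ R) (C := W ⧸ Y)
    (φ := (Y.comap π).subtype) (ψ := Y.mkQ ∘ₗ π) (Y.comap π).subtype_injective (Y.mkQ_surjective.comp hπ) ?_ fun g ↦ ?_
  · intro x
    simp
  -- Zorn's lemma is applied to partial maps on the free cover whose domains are preimages of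
  -- members of `𝓗`. A maximal one is total, because vanishing of `Ext¹` for the factor `N'/N`
  -- always allows one more step.
  let S : Set (LinearPMap (RingHom.id R) (W →₀ R) B) :=
    {f | ∃ N ∈ 𝓗, f.domain = N.comap π}
  obtain ⟨⟨dom, m⟩, hgm, ⟨⟨N, hN, hdom⟩, hmax⟩⟩ := zorn_le_nonempty₀ S (fun c hcS hc y hy ↦ by
    have hdir : DirectedOn (· ≤ ·) c := hc.directedOn
    refine ⟨LinearPMap.sSup c hdir, ?_, fun z hz ↦ LinearPMap.le_sSup hdir hz⟩
    -- Preimage along the surjection `π` reflects inclusion, so the members of `𝓗` occurring as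
    -- domains form a chain as well.
    have hchain : IsChain (· ≤ ·) {N | N ∈ 𝓗 ∧ ∃ f ∈ c, f.domain = N.comap π} := by
      rintro N ⟨-, f, hf, hfN⟩ N' ⟨-, f', hf', hfN'⟩ -
      have hle : N.comap π ≤ N'.comap π ∨ N'.comap π ≤ N.comap π := by
        rw [← hfN, ← hfN']
        exact (hc.total hf hf').imp (fun h ↦ h.1) (fun h ↦ h.1)
      simpa only [Submodule.comap_le_comap_iff_of_surjective hπ] using hle
    have hne : {N | N ∈ 𝓗 ∧ ∃ f ∈ c, f.domain = N.comap π}.Nonempty := by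
      obtain ⟨N, hN, h⟩ := hcS hy
      exact ⟨N, hN, y, hy, h⟩
    refine ⟨_, h𝓗.sSup_mem _ (fun N hN ↦ hN.1) hne hchain, ?_⟩
    ext x
    have hdir' : DirectedOn (· ≤ ·) (LinearPMap.domain '' c) :=
      directedOn_image.2 (hdir.mono @(LinearPMap.domain_mono.monotone))
    rw [LinearPMap.domain_sSup, Submodule.mem_sSup_of_directed (Set.Nonempty.image _ ⟨y, hy⟩) hdir',
      Submodule.mem_comap, Submodule.mem_sSup_of_directed hne hchain.directedOn]
    constructor
    · rintro ⟨_, ⟨f, hf, rfl⟩, hx⟩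
      obtain ⟨N, hN, h⟩ := hcS hf
      rw [h] at hx
      exact ⟨N, ⟨hN, f, hf, h⟩, hx⟩
    · rintro ⟨N, ⟨hN, f, hf, h⟩, hx⟩
      exact ⟨_, ⟨f, hf, rfl⟩, h ▸ hx⟩) ⟨Y.comap π, g⟩ ⟨Y, hY, rfl⟩
  dsimp only at hdom
  subst hdom
  obtain rfl : N = ⊤ := by
    by_contra hNtop
    obtain ⟨N', hN', hlt, hext⟩ := h𝓗.step N hN hNtop
    have hle : N.comap π ≤ N'.comap π := Submodule.comap_mono hlt.le
    obtain ⟨k, hk⟩ := hext.exists_extension (V := N.comap π) (X := N'.comap π)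
      (φ := Submodule.inclusion hle)
      (ψ := (N.submoduleOf N').mkQ ∘ₗ π.restrict (p := N'.comap π) (q := N') fun _ hx ↦ hx)
      (Submodule.inclusion_injective hle)
      ((Submodule.mkQ_surjective _).comp fun ⟨y, hy⟩ ↦ by
        obtain ⟨x, rfl⟩ := hπ y
        exact ⟨⟨x, hy⟩, rfl⟩)
      (fun x ↦ by
        simp only [LinearMap.comp_apply, Submodule.mkQ_apply, Submodule.Quotient.mk_eq_zero]
        constructor
        · intro hx
          exact ⟨⟨x.1, hx⟩, rfl⟩
        · rintro ⟨y, rfl⟩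
          exact y.2) m
    have hlem : (⟨N.comap π, m⟩ : LinearPMap (RingHom.id R) (W →₀ R) B) ≤ ⟨N'.comap π, k⟩ := by
      refine ⟨hle, fun x y hxy ↦ ?_⟩
      have : y = Submodule.inclusion hle x := Subtype.ext hxy.symm
      rw [this]
      exact (LinearMap.congr_fun hk x).symm
    have := (hmax ⟨N', hN', rfl⟩ hlem).1
    exact hlt.not_ge ((Submodule.comap_le_comap_iff_of_surjective hπ).1 this)
  refine ⟨m ∘ₗ LinearMap.codRestrict _ LinearMap.id fun _ ↦ trivial, LinearMap.ext fun x ↦ ?_⟩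
  exact (hgm.2 rfl).symm

/-- Well-ordering does both parts: the union of a set of terms is the term at the first index whose
term contains it, and the first term not contained in `F α` sits at a successor index. Passing to
that first index skips repeated terms, so the step is strict. -/
theorem isStepFamily_of_filtration {W : Type u} [AddCommGroup W] [Module R W]
    {p : Submodule R W → Submodule R W → Prop} {σ : Ordinal.{u}} {F : Ordinal.{u} → Submodule R W}
    (h0 : F 0 = ⊥) (hσ : F σ = ⊤) (hmono : ∀ α β, α ≤ β → β ≤ σ → F α ≤ F β)
    (hlim : ∀ α, α ≤ σ → Order.IsSuccLimit α → F α = ⨆ β : Set.Iio α, F β)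
    (hstep : ∀ α, α < σ → p (F α) (F (Order.succ α))) :
    IsStepFamily (F '' Set.Iic σ) p where
  sSup_mem c hc hne _ := by
    have hex : ∃ α, α ≤ σ ∧ sSup c ≤ F α := ⟨σ, le_rfl, hσ ▸ le_top⟩
    obtain ⟨α, ⟨hασ, hα⟩, hmin⟩ := WellFounded.has_min (wellFounded_lt (α := Ordinal.{u}))
      {α | α ≤ σ ∧ sSup c ≤ F α} hex
    have key : ∀ β < α, F (Order.succ β) ≤ sSup c := by
      intro β hβ
      have hβσ : β ≤ σ := hβ.le.trans hασ
      have hnot : ¬ sSup c ≤ F β := fun h ↦ hmin β ⟨hβσ, h⟩ hβ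
      obtain ⟨N, hN, hNβ⟩ : ∃ N ∈ c, ¬ N ≤ F β := by
        by_contra! hall
        exact hnot (sSup_le hall)
      obtain ⟨γ, hγ, rfl⟩ := hc hN
      have hβγ : β < γ := by
        by_contra! hγβ
        exact hNβ (hmono _ _ hγβ hβσ)
      exact (hmono _ _ (Order.succ_le_of_lt hβγ) hγ).trans (le_sSup hN)
    refine ⟨α, hασ, le_antisymm ?_ hα⟩
    obtain hα0 | ⟨β, hβ⟩ | hαlim := Ordinal.zero_or_succ_or_isSuccLimit α
    · rw [hα0, h0]
      exact bot_le
    · rw [← hβ]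
      exact key β (hβ ▸ Order.lt_succ β)
    · rw [hlim α hασ hαlim]
      exact iSup_le fun β ↦ (hmono _ _ (Order.le_succ _)
        ((Order.succ_le_of_lt β.2).trans hασ)).trans (key β β.2)
  step := by
    rintro _ ⟨α, hα, rfl⟩ hne
    have hex : ∃ β, β ≤ σ ∧ ¬ F β ≤ F α :=
      ⟨σ, le_rfl, fun h ↦ hne (top_le_iff.1 (hσ ▸ h))⟩
    obtain ⟨β, ⟨hβσ, hβ⟩, hmin⟩ := WellFounded.has_min (wellFounded_lt (α := Ordinal.{u}))
      {β | β ≤ σ ∧ ¬ F β ≤ F α} hex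
    have hlow : ∀ γ < β, F γ ≤ F α := fun γ hγ ↦ by
      by_contra hnot
      exact hmin γ ⟨hγ.le.trans hβσ, hnot⟩ hγ
    obtain hβ0 | ⟨γ, hγ⟩ | hβlim := Ordinal.zero_or_succ_or_isSuccLimit β
    · exact absurd (by rw [hβ0, h0]; exact bot_le) hβ
    · have hγβ : γ < β := hγ ▸ Order.lt_succ γ
      have hαγ : α ≤ γ := by
        by_contra! hlt
        exact hβ (hγ ▸ hmono _ _ (Order.succ_le_of_lt hlt) hα)
      have heq : F γ = F α := le_antisymm (hlow γ hγβ) (hmono _ _ hαγ (hγβ.le.trans hβσ))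
      refine ⟨F β, ⟨β, hβσ, rfl⟩, lt_of_le_of_ne
        (hmono _ _ (hαγ.trans hγβ.le) hβσ) fun h ↦ hβ h.ge, ?_⟩
      rw [← heq, ← hγ]
      exact hstep γ (hγβ.trans_le hβσ)
    · exact absurd (by rw [hlim β hβσ hβlim]; exact iSup_le fun γ ↦ hlow γ γ.2) hβ

/-- **Eklof's lemma**. -/
theorem extVanishes_of_mem_Filt {𝒮 : Set (ModuleCat.{u} R)} {B : ModuleCat.{u} R}
    (hB : B ∈ rightPerp 𝒮) {M : ModuleCat.{u} R} (hM : M ∈ Filt 𝒮) : ExtVanishes M B := by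
  obtain ⟨σ, F, h0, hσ, hmono, hlim, hstep⟩ := hM
  have h𝓗 := isStepFamily_of_filtration (p := fun N N' ↦ ExtVanishes (N' ⧸ N.submoduleOf N') B)
    h0 hσ hmono hlim fun α hα ↦ by
      obtain ⟨S, hS, ⟨e⟩⟩ := hstep α hα
      exact ExtVanishes.of_equiv (hB S hS) e
  exact (h𝓗.extVanishes ⟨0, zero_le (a := σ), h0⟩).of_equiv
    (Submodule.quotEquivOfEqBot (⊥ : Submodule R M) rfl).symm

/-- A step family containing `⊥` yields a filtration. -/
theorem IsStepFamily.mem_Filt {𝒮 : Set (ModuleCat.{u} R)} {M : ModuleCat.{u} R}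
    {𝓗 : Set (Submodule R M)}
    (h𝓗 : IsStepFamily 𝓗 fun N N' ↦
      ∃ S ∈ 𝒮, Nonempty ((N' ⧸ N.submoduleOf N') ≃ₗ[R] S)) (hbot : ⊥ ∈ 𝓗) : M ∈ Filt 𝒮 := by
  classical
  choose! next hmem hlt hiso using h𝓗.step
  -- Letting the successor fix `⊤` makes the recursion total. The single formula for `F` below
  -- covers zero, successor and limit stages together.
  let nx : Submodule R M → Submodule R M := fun N ↦ if N = ⊤ then ⊤ else next N
  let F : Ordinal.{u} → Submodule R M :=
    WellFounded.fix (wellFounded_lt (α := Ordinal.{u})) fun α f ↦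
      ⨆ β : Set.Iio α, nx (f β.1 β.2)
  have hF : ∀ α, F α = ⨆ β : Set.Iio α, nx (F β) := fun α ↦ WellFounded.fix_eq _ _ α
  have hnx : ∀ N ∈ 𝓗, N ≤ nx N := fun N hN ↦ by
    by_cases h : N = ⊤
    · simp [nx, h]
    · simpa [nx, h] using (hlt N hN h).le
  have hnx' : ∀ β α, β < α → nx (F β) ≤ F α := fun β α h ↦ by
    rw [hF α]
    exact le_iSup (fun β : Set.Iio α ↦ nx (F β)) ⟨β, h⟩
  have htop : ∀ β, F β = ⊤ → ∀ α, β ≤ α → F α = ⊤ := by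
    intro β hβ α hα
    obtain rfl | h := hα.eq_or_lt
    · exact hβ
    · have := hnx' β α h
      simpa [nx, hβ] using this
  have hF𝓗 : ∀ α, F α ≠ ⊤ → F α ∈ 𝓗 := by
    intro α
    induction α using WellFoundedLT.induction with
    | ind α ih =>
      intro hα
      have hβ : ∀ β < α, F β ≠ ⊤ ∧ F β ∈ 𝓗 := fun β hβ ↦
        have hne : F β ≠ ⊤ := fun h ↦ hα (htop β h α hβ.le)
        ⟨hne, ih β hβ hne⟩
      obtain rfl | hpos := eq_or_ne α 0
      · have : F 0 = ⊥ := by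
          rw [hF]
          simp
        rwa [this]
      · have hsup : F α = sSup ((fun β ↦ nx (F β)) '' Set.Iio α) := by
          rw [hF α, sSup_image, iSup_subtype]
        rw [hsup]
        refine h𝓗.sSup_mem _ ?_ ⟨_, 0, pos_iff_ne_zero.2 hpos, rfl⟩ ?_
        · rintro _ ⟨β, hβα, rfl⟩
          simpa [nx, (hβ β hβα).1] using hmem _ (hβ β hβα).2 (hβ β hβα).1
        · have hlt' : ∀ β γ, β < γ → γ < α → nx (F β) ≤ nx (F γ) := fun β γ h hγ ↦
            (hnx' β γ h).trans (hnx _ (hβ γ hγ).2)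
          rintro _ ⟨β, hβα, rfl⟩ _ ⟨γ, hγα, rfl⟩ -
          obtain h | rfl | h := lt_trichotomy β γ
          · exact Or.inl (hlt' _ _ h hγα)
          · exact Or.inl le_rfl
          · exact Or.inr (hlt' _ _ h hβα)
  have hle : ∀ α, F α ≤ nx (F α) := fun α ↦ by
    by_cases h : F α = ⊤
    · simp [nx, h]
    · exact hnx _ (hF𝓗 α h)
  have hmono : Monotone F := fun α β h ↦ by
    obtain rfl | h := h.eq_or_lt
    · exact le_rfl
    · exact (hle α).trans (hnx' α β h)
  have hsucc : ∀ α, F (Order.succ α) = nx (F α) := fun α ↦ by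
    refine le_antisymm ?_ (hnx' _ _ (Order.lt_succ α))
    rw [hF]
    refine iSup_le fun β ↦ ?_
    obtain h | h := (Order.lt_succ_iff.1 (Set.mem_Iio.1 β.2)).eq_or_lt
    · rw [h]
    · exact (hnx' _ _ h).trans (hle α)
  -- Otherwise `F` is strictly increasing and embeds all ordinals of the universe into the small
  -- type of submodules of `M`.
  have hex : ∃ α, F α = ⊤ := by
    by_contra! hall
    refine not_injective_of_ordinal F (StrictMono.injective fun α β h ↦ ?_)
    refine lt_of_lt_of_le ?_ (hnx' α β h)
    simpa [nx, hall α] using hlt _ (hF𝓗 α (hall α)) (hall α)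
  obtain ⟨σ, hσ, hmin⟩ := WellFounded.has_min (wellFounded_lt (α := Ordinal.{u})) {α | F α = ⊤} hex
  have hσ' : ∀ α < σ, F α ≠ ⊤ := fun α hα h ↦ hmin α h hα
  refine ⟨σ, F, ?_, hσ, fun α β h _ ↦ hmono h, fun α hα hlim ↦ ?_, fun α hα ↦ ?_⟩
  · rw [hF]
    simp
  · refine le_antisymm ?_ (iSup_le fun β ↦ hmono (le_of_lt β.2))
    rw [hF α]
    refine iSup_le fun β ↦ ?_
    rw [← hsucc]
    exact le_iSup (fun β : Set.Iio α ↦ F β) ⟨Order.succ β, hlim.succ_lt β.2⟩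
  · rw [hsucc]
    have hne := hσ' α hα
    rw [show nx (F α) = next (F α) from if_neg hne]
    exact hiso _ (hF𝓗 α hne) hne

/-! ### Cardinality bounds for sums of submodules. -/

section Cardinal

open Cardinal

variable {X : Type u} [AddCommGroup X] [Module R X] {κ : Cardinal.{u}}

theorem mk_iSup_le (hκ : ℵ₀ ≤ κ) {ι : Type u} (hι : #ι ≤ κ) (A : ι → Submodule R X)
    (hA : ∀ i, #(A i) ≤ κ) : #(⨆ i, A i : Submodule R X) ≤ κ := by
  -- Every element of the sum is the total of a finite list of elements of the summands, and for
  -- infinite `κ` there are at most `κ` such lists.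
  let f : List (Σ i, A i) → (⨆ i, A i : Submodule R X) := fun l ↦
    (l.map fun x ↦ (⟨x.2, Submodule.mem_iSup_of_mem x.1 x.2.2⟩ : (⨆ i, A i : Submodule R X))).sum
  have hf : Function.Surjective f := by
    rintro ⟨x, hx⟩
    induction hx using Submodule.iSup_induction' with
    | mem i x hx => exact ⟨[⟨i, x, hx⟩], by simp [f]⟩
    | zero => exact ⟨[], rfl⟩
    | add x y hx hy ihx ihy =>
      obtain ⟨l, hl⟩ := ihx
      obtain ⟨l', hl'⟩ := ihy
      refine ⟨l ++ l', ?_⟩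
      simp only [f, List.map_append, List.sum_append] at hl hl' ⊢
      rw [hl, hl']
      rfl
  refine (mk_le_of_surjective hf).trans ((mk_list_le_max _).trans (max_le hκ ?_))
  rw [mk_sigma]
  calc Cardinal.sum (fun i ↦ #(A i)) ≤ Cardinal.sum (fun _ : ι ↦ κ) := Cardinal.sum_le_sum _ _ hA
    _ = #ι * κ := by simp
    _ ≤ κ := (mul_le_mul_left hι κ).trans (mul_eq_self hκ).le

theorem mk_iUnion_le_of_le (hκ : ℵ₀ ≤ κ) {ι α : Type u} (hι : #ι ≤ κ) (s : ι → Set α)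
    (hs : ∀ i, #(s i) ≤ κ) : #(⋃ i, s i) ≤ κ :=
  mk_iUnion_le_sum_mk.trans <| (Cardinal.sum_le_sum _ (fun _ ↦ κ) hs).trans <| by
    simpa using (mul_le_mul_left hι κ).trans (mul_eq_self hκ).le

theorem mk_sup_le (hκ : ℵ₀ ≤ κ) {A B : Submodule R X} (hA : #A ≤ κ) (hB : #B ≤ κ) :
    #(A ⊔ B : Submodule R X) ≤ κ := by
  rw [sup_eq_iSup]
  have : (⨆ b : Bool, bif b then A else B) = ⨆ b : ULift.{u} Bool, bif b.down then A else B :=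
    (Equiv.ulift.iSup_comp (g := fun b : Bool ↦ bif b then A else B)).symm
  rw [this]
  refine mk_iSup_le hκ ((lt_aleph0_of_finite _).le.trans hκ) _ ?_
  rintro ⟨_ | _⟩
  · exact hB
  · exact hA

end Cardinal

/-! ### Hill families and their passage to direct summands. -/

open Cardinal

variable {X : Type u} [AddCommGroup X] [Module R X]

/-- A family of submodules as in the Hill lemma: closed under arbitrary sums, covering `X` by
members of cardinality at most `κ`, with all subfactors left orthogonal to `ℬ`. -/
structure IsHillFamily (𝓗 : Set (Submodule R X)) (κ : Cardinal.{u}) (ℬ : Set (ModuleCat.{u} R)) :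
    Prop where
  sSup_mem : ∀ c ⊆ 𝓗, sSup c ∈ 𝓗
  exists_mem : ∀ x : X, ∃ H ∈ 𝓗, x ∈ H ∧ #H ≤ κ
  extVanishes : ∀ H ∈ 𝓗, ∀ H' ∈ 𝓗, H ≤ H' → ∀ B ∈ ℬ, ExtVanishes (H' ⧸ H.submoduleOf H') B

namespace IsHillFamily

variable {𝓗 : Set (Submodule R X)} {κ : Cardinal.{u}} {ℬ : Set (ModuleCat.{u} R)}

theorem iSup_mem (h𝓗 : IsHillFamily 𝓗 κ ℬ) {ι : Type*} {A : ι → Submodule R X}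
    (hA : ∀ i, A i ∈ 𝓗) : ⨆ i, A i ∈ 𝓗 :=
  h𝓗.sSup_mem _ (by rintro _ ⟨i, rfl⟩; exact hA i)

theorem sup_mem (h𝓗 : IsHillFamily 𝓗 κ ℬ) {A B : Submodule R X} (hA : A ∈ 𝓗) (hB : B ∈ 𝓗) :
    A ⊔ B ∈ 𝓗 := by
  rw [← sSup_pair]
  exact h𝓗.sSup_mem _ (by rintro _ (rfl | rfl); exacts [hA, hB])

/-- Every element lies in a small member of a Hill family which is stable under a given
endomorphism. -/
theorem exists_stable (h𝓗 : IsHillFamily 𝓗 κ ℬ) (hκ : ℵ₀ ≤ κ) (e : X →ₗ[R] X) (x : X) :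
    ∃ H ∈ 𝓗, x ∈ H ∧ #H ≤ κ ∧ H.map e ≤ H := by
  choose h hh hxh hhκ using h𝓗.exists_mem
  -- Closing off: each stage adds a small member around the image under `e` of every element so far.
  -- The countable union is stable and still of size at most `κ`.
  let K : ℕ → Submodule R X :=
    fun n ↦ Nat.rec (h x) (fun _ (N : Submodule R X) ↦ N ⊔ ⨆ y : N, h (e y)) n
  have hK : ∀ n, K (n + 1) = K n ⊔ ⨆ y : K n, h (e y) := fun n ↦ rfl
  have hmem : ∀ n, K n ∈ 𝓗 := by
    intro n
    induction n with
    | zero => exact hh x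
    | succ n ih => exact hK n ▸ h𝓗.sup_mem ih (h𝓗.iSup_mem fun y ↦ hh _)
  have hcard : ∀ n, #{y // y ∈ K n} ≤ κ := by
    intro n
    induction n with
    | zero => exact hhκ x
    | succ n ih =>
      rw [hK]
      exact mk_sup_le hκ ih (mk_iSup_le hκ ih _ fun y ↦ hhκ _)
  refine ⟨⨆ n, K n, h𝓗.iSup_mem hmem, Submodule.mem_iSup_of_mem 0 (hxh x), ?_, ?_⟩
  · have : (⨆ n, K n) = ⨆ n : ULift.{u} ℕ, K n.down :=
      (Equiv.ulift.iSup_comp (g := fun n : ℕ ↦ K n)).symm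
    rw [this]
    exact mk_iSup_le hκ (by simpa using hκ) _ fun n ↦ hcard _
  · rw [Submodule.map_iSup]
    refine iSup_le fun n ↦ le_trans ?_ (le_iSup K (n + 1))
    rintro _ ⟨y, hy, rfl⟩
    rw [hK]
    exact Submodule.mem_sup_right (Submodule.mem_iSup_of_mem ⟨y, hy⟩ (hxh (e y)))

/-- The images of the stable members of a Hill family form a step family of a direct summand. -/
theorem isStepFamily_summand (h𝓗 : IsHillFamily 𝓗 κ ℬ) (hκ : ℵ₀ ≤ κ)
    {M : Type u} [AddCommGroup M] [Module R M] (i : M →ₗ[R] X) (π : X →ₗ[R] M)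
    (hπi : ∀ m, π (i m) = m) :
    IsStepFamily {N : Submodule R M | ∃ H ∈ 𝓗, H.map (i ∘ₗ π) ≤ H ∧ H.map π = N} fun N N' ↦
      #(N' ⧸ N.submoduleOf N') ≤ κ ∧ ∀ B ∈ ℬ, ExtVanishes (N' ⧸ N.submoduleOf N') B where
  sSup_mem c hc _ _ := by
    choose! H hH hst hmap using fun (N : Submodule R M) (hN : N ∈ c) ↦ hc hN
    refine ⟨⨆ N : c, H N, h𝓗.iSup_mem fun N ↦ hH N N.2, ?_, ?_⟩
    · rw [Submodule.map_iSup]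
      exact iSup_mono fun N ↦ hst N N.2
    · rw [Submodule.map_iSup, sSup_eq_iSup']
      exact iSup_congr fun N ↦ hmap N N.2
  step := by
    rintro _ ⟨H, hH, hst, rfl⟩ hne
    obtain ⟨x, hx⟩ : ∃ x, x ∉ H.map π := by
      by_contra! hall
      exact hne (Submodule.eq_top_iff'.2 hall)
    obtain ⟨H₀, hH₀, hxH₀, hcard, hst₀⟩ := h𝓗.exists_stable hκ (i ∘ₗ π) (i x)
    have hst' : (H ⊔ H₀).map (i ∘ₗ π) ≤ H ⊔ H₀ := by
      rw [Submodule.map_sup]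
      exact sup_le_sup hst hst₀
    -- Stability under the idempotent `i ∘ π` says exactly that `i` carries `π(K)` back into `K`.
    -- Hence `π(H ⊔ H₀) / π(H)` is a retract of `(H ⊔ H₀) / H`, and inherits its orthogonality.
    have hi : ∀ K : Submodule R X, K.map (i ∘ₗ π) ≤ K → ∀ m ∈ K.map π, i m ∈ K := by
      rintro K hK _ ⟨y, hy, rfl⟩
      exact hK ⟨y, hy, rfl⟩
    refine ⟨(H ⊔ H₀).map π, ⟨_, h𝓗.sup_mem hH hH₀, hst', rfl⟩, ?_, ?_, fun B hB ↦ ?_⟩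
    · refine lt_of_le_of_ne (Submodule.map_mono le_sup_left) fun heq ↦ hx ?_
      rw [heq]
      exact ⟨i x, Submodule.mem_sup_right hxH₀, hπi x⟩
    · let f : H₀ → ((H ⊔ H₀).map π) ⧸ ((H.map π).submoduleOf ((H ⊔ H₀).map π)) := fun y ↦
        Submodule.Quotient.mk ⟨π y, y, Submodule.mem_sup_right y.2, rfl⟩
      refine (mk_le_of_surjective (f := f) fun q ↦ ?_).trans hcard
      obtain ⟨⟨_, y, hy, rfl⟩, rfl⟩ := Submodule.Quotient.mk_surjective _ q
      obtain ⟨a, ha, b, hb, rfl⟩ := Submodule.mem_sup.1 hy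
      refine ⟨⟨b, hb⟩, ?_⟩
      rw [Submodule.Quotient.eq]
      exact ⟨-a, H.neg_mem ha, by simp⟩
    · refine (h𝓗.extVanishes H hH _ (h𝓗.sup_mem hH hH₀) le_sup_left B hB).of_retract
        (Submodule.mapQ _ _ (i.restrict (p := (H ⊔ H₀).map π) (q := H ⊔ H₀) (hi _ hst'))
          fun m hm ↦ hi H hst _ hm)
        (Submodule.mapQ _ _ (π.restrict (p := H ⊔ H₀) (q := (H ⊔ H₀).map π)
          fun y hy ↦ ⟨y, hy, rfl⟩) fun y hy ↦ ⟨y.1, hy, rfl⟩) fun q ↦ ?_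
      obtain ⟨m, rfl⟩ := Submodule.Quotient.mk_surjective _ q
      exact congrArg Submodule.Quotient.mk (Subtype.ext (hπi m))

end IsHillFamily

/-! ### Hill's lemma. -/

section Hill

variable {ι : Type u} (A : ι → Submodule R X)

/-- The sum of the submodules `A i` for `i ∈ T`. -/
def partialSum (T : Set ι) : Submodule R X := ⨆ i : T, A i

variable {A}

theorem le_partialSum {T : Set ι} {i : ι} (hi : i ∈ T) : A i ≤ partialSum A T :=
  le_iSup (fun i : T ↦ A i) ⟨i, hi⟩

theorem partialSum_le {T : Set ι} {N : Submodule R X} (h : ∀ i ∈ T, A i ≤ N) :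
    partialSum A T ≤ N :=
  iSup_le fun i ↦ h i i.2

theorem partialSum_mono {T T' : Set ι} (h : T ⊆ T') : partialSum A T ≤ partialSum A T' :=
  partialSum_le fun _ hi ↦ le_partialSum (h hi)

theorem mem_partialSum {T : Set ι} {i : ι} {x : X} (hx : x ∈ A i) (hi : i ∈ T) :
    x ∈ partialSum A T :=
  le_partialSum hi hx

theorem mem_partialSum_of_subset {T T' : Set ι} {x : X} (hx : x ∈ partialSum A T) (h : T ⊆ T') :
    x ∈ partialSum A T' :=
  partialSum_mono h hx

theorem partialSum_empty : partialSum A ∅ = ⊥ :=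
  eq_bot_iff.2 (partialSum_le fun _ hi ↦ hi.elim)

theorem partialSum_singleton (i : ι) : partialSum A {i} = A i :=
  le_antisymm (partialSum_le (by rintro _ rfl; exact le_rfl)) (le_partialSum rfl)

theorem partialSum_sUnion (c : Set (Set ι)) :
    partialSum A (⋃₀ c) = sSup (partialSum A '' c) := by
  refine le_antisymm (partialSum_le ?_) (sSup_le ?_)
  · rintro i ⟨T, hT, hi⟩
    exact (le_partialSum hi).trans (le_sSup ⟨T, hT, rfl⟩)
  · rintro _ ⟨T, hT, rfl⟩
    exact partialSum_mono (Set.subset_sUnion_of_mem hT)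

theorem partialSum_union (T T' : Set ι) :
    partialSum A (T ∪ T') = partialSum A T ⊔ partialSum A T' := by
  rw [← Set.sUnion_pair, partialSum_sUnion, Set.image_pair, sSup_pair]

theorem exists_finite_of_mem_partialSum {T : Set ι} {x : X} (hx : x ∈ partialSum A T) :
    ∃ t : Set ι, t.Finite ∧ t ⊆ T ∧ x ∈ partialSum A t := by
  obtain ⟨s, hs⟩ := Submodule.exists_finset_of_mem_iSup _ hx
  refine ⟨Subtype.val '' (s : Set T), s.finite_toSet.image _, by rintro _ ⟨i, -, rfl⟩; exact i.2, ?_⟩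
  have : (⨆ i ∈ s, A i) ≤ partialSum A (Subtype.val '' (s : Set T)) :=
    iSup₂_le fun i hi ↦ le_partialSum ⟨i, hi, rfl⟩
  exact this hs

variable [LinearOrder ι]

variable (A) in
/-- The closed subsets of the index set in the Hill lemma. -/
def IsHillClosed (T : Set ι) : Prop :=
  ∀ i ∈ T, A i ⊓ partialSum A (Set.Iio i) ≤ partialSum A (T ∩ Set.Iio i)

theorem exists_bound_of_mem_partialSum {T : Set ι} {x : X} (hx : x ∈ partialSum A T) :
    x = 0 ∨ ∃ k ∈ T, x ∈ partialSum A (T ∩ Set.Iic k) := by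
  obtain ⟨t, htf, htT, hxt⟩ := exists_finite_of_mem_partialSum hx
  obtain rfl | hne := t.eq_empty_or_nonempty
  · left
    simpa [partialSum_empty] using hxt
  · right
    obtain ⟨k, hk, hmax⟩ := htf.exists_maximal hne
    refine ⟨k, htT hk, mem_partialSum_of_subset hxt fun j hj ↦ ⟨htT hj, ?_⟩⟩
    exact (le_total j k).elim id fun h ↦ hmax hj h

theorem isHillClosed_sUnion {c : Set (Set ι)} (hc : ∀ T ∈ c, IsHillClosed A T) :
    IsHillClosed A (⋃₀ c) := by
  rintro i ⟨T, hT, hi⟩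
  exact (hc T hT i hi).trans
    (partialSum_mono (Set.inter_subset_inter_left _ (Set.subset_sUnion_of_mem hT)))

theorem isHillClosed_iUnion {α : Type*} {T : α → Set ι} (hT : ∀ a, IsHillClosed A (T a)) :
    IsHillClosed A (⋃ a, T a) := by
  rw [← Set.sUnion_range]
  exact isHillClosed_sUnion (by rintro _ ⟨a, rfl⟩; exact hT a)

variable [WellFoundedLT ι]

/-- Descent on the top index `k` used to write `x` over `T`. If `k > i`, the component of `x` in `A
k` already lies in the sum of the `A j` with `j < k`, so closedness rewrites it with smaller indices
from `T`. -/
theorem IsHillClosed.mem_partialSum_inter_Iic {T : Set ι} (hT : IsHillClosed A T) {i : ι} {x : X}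
    (hx : x ∈ partialSum A T) (hxi : x ∈ partialSum A (Set.Iic i)) :
    x ∈ partialSum A (T ∩ Set.Iic i) := by
  have key : ∀ k, x ∈ partialSum A (T ∩ Set.Iic k) → x ∈ partialSum A (T ∩ Set.Iic i) := by
    intro k
    induction k using WellFoundedLT.induction with
    | ind k ih =>
      intro hk
      obtain hki | hik := le_or_gt k i
      · exact mem_partialSum_of_subset hk (Set.inter_subset_inter_right _ (Set.Iic_subset_Iic.2 hki))
      have hk' : x ∈ partialSum A (T ∩ Set.Iio k) := by
        by_cases hkT : k ∈ T
        · have heq : T ∩ Set.Iic k = {k} ∪ T ∩ Set.Iio k := by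
            ext j
            simp only [Set.mem_inter_iff, Set.mem_Iic, Set.mem_union, Set.mem_singleton_iff,
              Set.mem_Iio, le_iff_eq_or_lt]
            grind
          rw [heq, partialSum_union, partialSum_singleton] at hk
          obtain ⟨a, ha, b, hb, hab⟩ := Submodule.mem_sup.1 hk
          have hb' : b ∈ partialSum A (Set.Iio k) :=
            mem_partialSum_of_subset hb Set.inter_subset_right
          have hx' : x ∈ partialSum A (Set.Iio k) :=
            mem_partialSum_of_subset hxi fun j hj ↦ (Set.mem_Iic.1 hj).trans_lt hik
          have ha'' : a ∈ partialSum A (Set.Iio k) := by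
            rw [eq_sub_of_add_eq hab]
            exact Submodule.sub_mem _ hx' hb'
          rw [← hab]
          exact Submodule.add_mem _ (hT k hkT ⟨ha, ha''⟩) hb
        · refine mem_partialSum_of_subset hk fun j hj ↦ ⟨hj.1, lt_of_le_of_ne hj.2 ?_⟩
          rintro rfl
          exact hkT hj.1
      obtain rfl | ⟨j, hj, hxj⟩ := exists_bound_of_mem_partialSum hk'
      · exact Submodule.zero_mem _
      · exact ih j hj.2 (mem_partialSum_of_subset hxj
          (Set.inter_subset_inter_left _ Set.inter_subset_left))
  obtain rfl | ⟨k, hk, hxk⟩ := exists_bound_of_mem_partialSum hx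
  · exact Submodule.zero_mem _
  · exact key k hxk

/-- With closedness, this identifies the factor obtained on adding a new index `i` to a closed set
with the original factor at `i`. -/
theorem IsHillClosed.inf_le {T : Set ι} (hT : IsHillClosed A T) {i : ι} (hi : i ∉ T) :
    A i ⊓ partialSum A T ≤ partialSum A (Set.Iio i) := by
  rintro x ⟨hxi, hxT⟩
  refine mem_partialSum_of_subset
    (hT.mem_partialSum_inter_Iic hxT (mem_partialSum hxi Set.self_mem_Iic)) fun j hj ↦ ?_
  refine lt_of_le_of_ne hj.2 ?_
  rintro rfl
  exact hi hj.1

variable {κ : Cardinal.{u}} {ℬ : Set (ModuleCat.{u} R)}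

/-- Each of the at most `κ` elements of `A i` that are sums of earlier terms involves finitely many
smaller indices. By induction each of these lies in a small closed set, and the union of all of them
together with `i` is closed. -/
theorem exists_small_isHillClosed (hκ : ℵ₀ ≤ κ) (hA : ∀ i, #(A i) ≤ κ) (i : ι) :
    ∃ T : Set ι, IsHillClosed A T ∧ i ∈ T ∧ #T ≤ κ := by
  induction i using WellFoundedLT.induction with
  | ind i ih =>
    choose! T hT hmem hcard using ih
    have hfin : ∀ x : (A i ⊓ partialSum A (Set.Iio i) : Submodule R X), ∃ t : Set ι,
        t.Finite ∧ t ⊆ Set.Iio i ∧ (x : X) ∈ partialSum A t :=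
      fun x ↦ exists_finite_of_mem_partialSum x.2.2
    choose t htf hti hxt using hfin
    let U : Set ι := ⋃ x, ⋃ j : t x, T j
    have hU : IsHillClosed A U :=
      isHillClosed_iUnion fun x ↦ isHillClosed_iUnion fun j ↦ hT j (hti x j.2)
    have htU : ∀ x, t x ⊆ U := fun x j hj ↦
      Set.mem_iUnion.2 ⟨x, Set.mem_iUnion.2 ⟨⟨j, hj⟩, hmem j (hti x hj)⟩⟩
    refine ⟨{i} ∪ U, ?_, Or.inl rfl, ?_⟩
    · rintro j (rfl | hj)
      · intro x hx
        exact mem_partialSum_of_subset (hxt ⟨x, hx⟩)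
          fun k hk ↦ ⟨Or.inr (htU ⟨x, hx⟩ hk), hti ⟨x, hx⟩ hk⟩
      · exact (hU j hj).trans
          (partialSum_mono (Set.inter_subset_inter_left _ Set.subset_union_right))
    · refine (mk_union_le _ _).trans (add_le_of_le hκ ?_ ?_)
      · simpa using one_le_aleph0.trans hκ
      · refine mk_iUnion_le_of_le hκ ((mk_subtype_mono fun x hx ↦ hx.1).trans (hA i)) _ fun x ↦ ?_
        have := (htf x).to_subtype
        exact mk_iUnion_le_of_le hκ ((lt_aleph0_of_finite _).le.trans hκ) _
          fun j ↦ hcard j (hti x j.2)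

omit [LinearOrder ι] [WellFoundedLT ι] in
theorem mk_partialSum_le (hκ : ℵ₀ ≤ κ) {T : Set ι} (hT : #T ≤ κ) (hA : ∀ i, #(A i) ≤ κ) :
    #(partialSum A T) ≤ κ :=
  mk_iSup_le hκ hT _ fun i ↦ hA i

theorem exists_small_partialSum (hκ : ℵ₀ ≤ κ) (hA : ∀ i, #(A i) ≤ κ) (htop : ⨆ i, A i = ⊤)
    (x : X) : ∃ T : Set ι, IsHillClosed A T ∧ x ∈ partialSum A T ∧ #(partialSum A T) ≤ κ := by
  have hx : x ∈ partialSum A Set.univ := by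
    have : (⊤ : Submodule R X) ≤ partialSum A Set.univ :=
      htop ▸ iSup_le fun i ↦ le_partialSum (Set.mem_univ i)
    exact this trivial
  obtain ⟨t, htf, -, hxt⟩ := exists_finite_of_mem_partialSum hx
  choose T hT hmem hcard using fun i ↦ exists_small_isHillClosed hκ hA i
  have := htf.to_subtype
  refine ⟨⋃ i : t, T i, isHillClosed_iUnion fun i ↦ hT i,
    mem_partialSum_of_subset hxt fun i hi ↦ Set.mem_iUnion.2 ⟨⟨i, hi⟩, hmem i⟩, ?_⟩
  exact mk_partialSum_le hκ (mk_iUnion_le_of_le hκ ((lt_aleph0_of_finite _).le.trans hκ) _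
    fun i ↦ hcard i) hA

/-- The sums over closed sets between `T` and `T'` form a step family with factors from the original
filtration, so Eklof's lemma applies. -/
theorem IsHillClosed.extVanishes {B : ModuleCat.{u} R}
    (hA : ∀ i, ExtVanishes (A i ⧸ (partialSum A (Set.Iio i)).submoduleOf (A i)) B)
    {T T' : Set ι} (hT : IsHillClosed A T) (hT' : IsHillClosed A T') (hTT' : T ⊆ T') :
    ExtVanishes (partialSum A T' ⧸ (partialSum A T).submoduleOf (partialSum A T')) B := by
  set W := partialSum A T' with hW
  have hmap : ∀ N ≤ W, (N.submoduleOf W).map W.subtype = N := fun N hN ↦ by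
    rw [Submodule.submoduleOf, Submodule.map_comap_subtype, inf_eq_right.2 hN]
  refine IsStepFamily.extVanishes
    (𝓗 := {N | ∃ U, IsHillClosed A U ∧ T ⊆ U ∧ U ⊆ T' ∧ (partialSum A U).submoduleOf W = N})
    ⟨fun c hc hne _ ↦ ?_, ?_⟩ ⟨T, hT, subset_rfl, hTT', rfl⟩
  · let 𝒰 : Set (Set ι) :=
      {U | IsHillClosed A U ∧ T ⊆ U ∧ U ⊆ T' ∧ (partialSum A U).submoduleOf W ∈ c}
    refine ⟨⋃₀ 𝒰, isHillClosed_sUnion fun U hU ↦ hU.1, ?_, Set.sUnion_subset fun U hU ↦ hU.2.2.1,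
      le_antisymm ?_ (sSup_le fun N hN ↦ ?_)⟩
    · obtain ⟨N, hN⟩ := hne
      obtain ⟨U, hU, hTU, hUT, rfl⟩ := hc hN
      exact Set.subset_sUnion_of_subset 𝒰 U hTU ⟨hU, hTU, hUT, hN⟩
    · have : partialSum A (⋃₀ 𝒰) ≤ (sSup c).map W.subtype := by
        rw [partialSum_sUnion]
        refine sSup_le ?_
        rintro _ ⟨U, hU, rfl⟩
        rw [← hmap (partialSum A U) (partialSum_mono hU.2.2.1)]
        exact Submodule.map_mono (le_sSup hU.2.2.2)
      exact (Submodule.comap_mono this).trans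
        (Submodule.comap_map_eq_of_injective W.injective_subtype _).le
    · obtain ⟨U, hU, hTU, hUT, rfl⟩ := hc hN
      exact Submodule.comap_mono (partialSum_mono
        (Set.subset_sUnion_of_mem ⟨hU, hTU, hUT, hN⟩))
  · rintro _ ⟨U, hU, hTU, hUT, rfl⟩ hne
    have hex : {i | i ∈ T' ∧ ¬ A i ≤ partialSum A U}.Nonempty := by
      by_contra hall
      simp only [Set.Nonempty, Set.mem_ofPred_eq, not_exists, not_and, not_not] at hall
      exact hne (Submodule.comap_subtype_eq_top.2 (partialSum_le hall))
    obtain ⟨i, ⟨hiT', hi⟩, hmin⟩ := WellFounded.has_min (wellFounded_lt (α := ι)) _ hex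
    have hlow : ∀ j ∈ T', j < i → A j ≤ partialSum A U := fun j hj hji ↦ by
      by_contra hnot
      exact hmin j ⟨hj, hnot⟩ hji
    -- Adding only `i` to `U` could destroy closedness. Adding first the indices of `T'` below `i`
    -- repairs this without changing the sum, by minimality of `i`.
    let V : Set ι := U ∪ T' ∩ Set.Iio i
    have hVU : partialSum A V = partialSum A U := by
      rw [partialSum_union, sup_eq_left]
      exact partialSum_le fun j hj ↦ hlow j hj.1 hj.2
    have hsub : ∀ j ∈ T', j ≤ i →
        A j ⊓ partialSum A (Set.Iio j) ≤ partialSum A ((T' ∩ Set.Iio i) ∩ Set.Iio j) :=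
      fun j hj hji ↦ (hT' j hj).trans
        (partialSum_mono fun k hk ↦ ⟨⟨hk.1, hk.2.trans_le hji⟩, hk.2⟩)
    have hV : IsHillClosed A V := by
      rintro j (hj | hj)
      · exact (hU j hj).trans
          (partialSum_mono (Set.inter_subset_inter_left _ Set.subset_union_left))
      · exact (hsub j hj.1 (le_of_lt hj.2)).trans
          (partialSum_mono (Set.inter_subset_inter_left _ Set.subset_union_right))
    have hVi : IsHillClosed A (V ∪ {i}) := by
      rintro j (hj | rfl)
      · exact (hV j hj).trans
          (partialSum_mono (Set.inter_subset_inter_left _ Set.subset_union_left))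
      · exact (hsub _ hiT' le_rfl).trans (partialSum_mono
          (Set.inter_subset_inter_left _ fun k hk ↦ Or.inl (Or.inr hk)))
    have hiV : i ∉ V := fun h ↦ hi (hVU ▸ le_partialSum h)
    have hsum : partialSum A (V ∪ {i}) = partialSum A U ⊔ A i := by
      rw [partialSum_union, hVU, partialSum_singleton]
    have hViT' : V ∪ {i} ⊆ T' := by
      rintro j ((hj | hj) | rfl)
      exacts [hUT hj, hj.1, hiT']
    refine ⟨_, ⟨V ∪ {i}, hVi, fun j hj ↦ Or.inl (Or.inl (hTU hj)), hViT', rfl⟩, ?_, ?_⟩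
    · refine lt_of_le_of_ne (Submodule.comap_mono (hsum ▸ le_sup_left)) fun heq ↦ hi ?_
      have := congrArg (Submodule.map W.subtype) heq
      rw [hmap _ (partialSum_mono hUT), hmap _ (partialSum_mono hViT')] at this
      rw [this, hsum]
      exact le_sup_right
    · set N := (partialSum A U).submoduleOf W
      set N' := (partialSum A (V ∪ {i})).submoduleOf W
      let f : A i →ₗ[R] N' :=
        { toFun := fun a ↦ ⟨⟨a, mem_partialSum a.2 hiT'⟩, mem_partialSum (T := V ∪ {i}) a.2 (Or.inr rfl)⟩
          map_add' := fun _ _ ↦ rfl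
          map_smul' := fun _ _ ↦ rfl }
      have hker : LinearMap.ker ((N.submoduleOf N').mkQ ∘ₗ f) =
          (partialSum A (Set.Iio i)).submoduleOf (A i) := by
        ext a
        rw [LinearMap.mem_ker, LinearMap.comp_apply, Submodule.mkQ_apply,
          Submodule.Quotient.mk_eq_zero]
        change (a : X) ∈ partialSum A U ↔ (a : X) ∈ partialSum A (Set.Iio i)
        rw [← hVU]
        refine ⟨fun h ↦ hV.inf_le hiV ⟨a.2, h⟩, fun h ↦ ?_⟩
        exact mem_partialSum_of_subset (hT' i hiT' ⟨a.2, h⟩) fun j hj ↦ Or.inr hj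
      have hsurj : Function.Surjective ((N.submoduleOf N').mkQ ∘ₗ f) := by
        intro q
        obtain ⟨⟨⟨x, hxW⟩, hx⟩, rfl⟩ := Submodule.Quotient.mk_surjective _ q
        have hx' : x ∈ partialSum A U ⊔ A i := hsum ▸ hx
        obtain ⟨a, ha, b, hb, rfl⟩ := Submodule.mem_sup.1 hx'
        refine ⟨⟨b, hb⟩, ?_⟩
        rw [LinearMap.comp_apply, Submodule.mkQ_apply, Submodule.Quotient.eq]
        change b - (a + b) ∈ partialSum A U
        simpa using ha
      exact (hA i).of_equiv (((Submodule.quotEquivOfEq _ _ hker.symm).trans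
        (LinearMap.quotKerEquivOfSurjective _ hsurj)).symm)

/-- **Hill's lemma**. -/
theorem isHillFamily_image_partialSum (hκ : ℵ₀ ≤ κ) (hcard : ∀ i, #(A i) ≤ κ)
    (htop : ⨆ i, A i = ⊤)
    (hA : ∀ B ∈ ℬ, ∀ i, ExtVanishes (A i ⧸ (partialSum A (Set.Iio i)).submoduleOf (A i)) B) :
    IsHillFamily (partialSum A '' {T | IsHillClosed A T}) κ ℬ where
  sSup_mem c hc := by
    choose! T hT hTc using hc
    refine ⟨⋃₀ (T '' c), isHillClosed_sUnion (by rintro _ ⟨N, hN, rfl⟩; exact hT hN), ?_⟩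
    rw [partialSum_sUnion, Set.image_image]
    congr 1
    exact (Set.image_congr fun N hN ↦ hTc hN).trans (Set.image_id' c)
  exists_mem x := by
    obtain ⟨T, hT, hx, h⟩ := exists_small_partialSum hκ hcard htop x
    exact ⟨_, ⟨T, hT, rfl⟩, hx, h⟩
  extVanishes := by
    rintro _ ⟨T, hT, rfl⟩ _ ⟨T', hT', rfl⟩ hle B hB
    -- Inclusion of the sums does not give `T ⊆ T'`, so `T'` is replaced by `T ∪ T'`, which has the
    -- same sum.
    have hU : IsHillClosed A (T ∪ T') := by
      rw [← Set.sUnion_pair]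
      exact isHillClosed_sUnion (by rintro _ (rfl | rfl); exacts [hT, hT'])
    have heq : partialSum A T' = partialSum A (T ∪ T') := by
      rw [partialSum_union, sup_eq_right.2 hle]
    rw [heq]
    exact hT.extVanishes (hA B hB) hU Set.subset_union_left

end Hill

/-! ### The small object argument and filtrations by cells. -/

section CellComplex

open Limits HomotopicalAlgebra MorphismProperty

/-- Lexicographic order, by `r` first and then by an arbitrary well-order. It serves to order the
cells of a complex compatibly with the stage at which they are attached. -/
theorem exists_wellOrder_monotone {α J : Type*} [LinearOrder J] [WellFoundedLT J] (r : α → J) :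
    ∃ (_ : LinearOrder α) (_ : WellFoundedLT α), Monotone r := by
  obtain ⟨i⟩ : Nonempty (α ≃ (Cardinal.mk α).ord.ToType) := Cardinal.eq.1 (by simp)
  let e : α → J ×ₗ (Cardinal.mk α).ord.ToType := fun a ↦ toLex (r a, i a)
  have he : Function.Injective e :=
    fun a b h ↦ i.injective (congrArg Prod.snd (toLex.injective h))
  let _ : LinearOrder α := LinearOrder.lift' e he
  have hmono : StrictMono e := fun _ _ h ↦ h
  refine ⟨inferInstance, hmono.wellFoundedLT, fun a b h ↦ ?_⟩
  have h' : e a ≤ e b := h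
  obtain h' | h' := Prod.Lex.le_iff.1 h'
  · exact h'.le
  · exact h'.1.le

variable {J : Type u} [LinearOrder J] [OrderBot J] [SuccOrder J] [WellFoundedLT J]
  {α : Type*} {A B : α → ModuleCat.{u} R} {g : ∀ a, A a ⟶ B a} {X Y : ModuleCat.{u} R} {f : X ⟶ Y}

/-- Applied to a quotient map, this shows that each stage lies in the sum of the cells attached
before it, since the complex starts from nothing when `f = 0`. -/
theorem incl_app_comp_eq_zero (c : RelativeCellComplex.{u} (fun _ : J ↦ g) f) (hf : f = 0)
    {Z : ModuleCat.{u} R} (φ : Y ⟶ Z) (j : J) (h : ∀ γ : c.Cells, γ.j < j → γ.ι ≫ φ = 0) :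
    c.incl.app j ≫ φ = 0 := by
  induction j using SuccOrder.limitRecOn with
  | isMin j hj =>
    obtain rfl := hj.eq_bot
    have : c.isoBot.inv ≫ c.incl.app ⊥ = 0 := c.fac.trans hf
    rw [← cancel_epi c.isoBot.inv]
    exact (Category.assoc _ _ _).symm.trans (by rw [this]; simp)
  | succ j hj ih =>
    apply (c.attachCells j hj).hom_ext
    · have := ih fun γ hγ ↦ h γ (hγ.trans (Order.lt_succ_of_not_isMax hj))
      simpa using this
    · intro k
      have := h ⟨j, hj, k⟩ (Order.lt_succ_of_not_isMax hj)
      exact ((Category.assoc _ _ _).symm.trans this).trans comp_zero.symm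
  | isSuccLimit j hj ih =>
    refine (c.F.isColimitOfIsWellOrderContinuous j hj).hom_ext fun ⟨k, hk⟩ ↦ ?_
    have hk0 := ih k hk fun γ hγ ↦ h γ (hγ.trans hk)
    have hw : c.F.map (homOfLE (Set.mem_Iio.1 hk).le) ≫ c.incl.app j = c.incl.app k := by simp
    exact ((Category.assoc _ _ _).symm.trans ((congrArg (· ≫ φ) hw).trans hk0)).trans
      comp_zero.symm

theorem mono_incl_app [∀ a, Mono (g a)] (c : RelativeCellComplex.{u} (fun _ : J ↦ g) f) (j : J) :
    Mono (c.incl.app j) := by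
  let c' : (monomorphisms (ModuleCat.{u} R)).TransfiniteCompositionOfShape J f :=
    { toTransfiniteCompositionOfShape := c.toTransfiniteCompositionOfShape
      map_mem j hj := by
        have h := (c.attachCells j hj).pushouts_coproducts
        refine (?_ : _ ≤ monomorphisms (ModuleCat.{u} R)) _ h
        rw [pushouts_le_iff, coproducts_le_iff]
        rintro _ _ _ ⟨a⟩
        exact inferInstanceAs (Mono (g a)) }
  exact c'.mem_incl_app j

/-- The projection of a module obtained by attaching cells to the cokernel of a single cell. -/
theorem exists_cell_projection {X₁ X₂ : ModuleCat.{u} R} {t : X₁ ⟶ X₂}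
    (c : AttachCells.{u} g t) (k : c.ι) :
    ∃ ρ : X₂ ⟶ ModuleCat.of R (B (c.π k) ⧸ LinearMap.range (g (c.π k)).hom),
      t ≫ ρ = 0 ∧ (∀ k', k' ≠ k → c.cell k' ≫ ρ = 0) ∧
        c.cell k ≫ ρ = ModuleCat.ofHom (Submodule.mkQ _) := by
  classical
  let q : ∀ k', B (c.π k') ⟶ ModuleCat.of R (B (c.π k) ⧸ LinearMap.range (g (c.π k)).hom) :=
    fun k' ↦ if h : k' = k then eqToHom (by rw [h]) ≫ ModuleCat.ofHom (Submodule.mkQ _) else 0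
  have hqk : q k = ModuleCat.ofHom (Submodule.mkQ _) := by simp [q]
  have hq : ∀ k', g (c.π k') ≫ q k' = 0 := by
    intro k'
    by_cases h : k' = k
    · subst h
      rw [hqk]
      ext x
      exact (Submodule.Quotient.mk_eq_zero _).2 ⟨x, rfl⟩
    · simp [q, h]
  let d : c.cofan₂.pt ⟶ _ := Cofan.IsColimit.desc c.isColimit₂ q
  have hd : ∀ k', c.cofan₂.inj k' ≫ d = q k' := Cofan.IsColimit.fac c.isColimit₂ q
  have hcomm : c.g₁ ≫ 0 = c.m ≫ d := by
    apply Cofan.IsColimit.hom_ext c.isColimit₁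
    intro k'
    rw [c.hm_assoc, hd, hq]
    simp
  refine ⟨c.isPushout.desc 0 d hcomm, by simp, fun k' hk' ↦ ?_, ?_⟩
  · rw [AttachCells.cell_def, Category.assoc, c.isPushout.inr_desc, hd]
    simp [q, hk']
  · rw [AttachCells.cell_def, Category.assoc, c.isPushout.inr_desc, hd, hqk]

/-- The part of a cell that lies in the earlier cells is exactly its boundary. The boundary is glued
to a previous stage, which earlier cells generate; conversely, the projection onto the cokernel of
this cell kills all earlier cells, including those attached at the same stage. -/
theorem exists_order_cells [∀ a, Mono (g a)] (c : RelativeCellComplex.{u} (fun _ : J ↦ g) f)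
    (hf : f = 0) :
    ∃ (_ : LinearOrder c.Cells) (_ : WellFoundedLT c.Cells),
      ⨆ γ : c.Cells, LinearMap.range γ.ι.hom = ⊤ ∧
      ∀ γ : c.Cells, (partialSum (fun γ : c.Cells ↦ LinearMap.range γ.ι.hom) (Set.Iio γ)).comap
        γ.ι.hom = LinearMap.range (g γ.i).hom := by
  obtain ⟨lo, wf, hmono⟩ := exists_wellOrder_monotone (RelativeCellComplex.Cells.j (c := c))
  refine ⟨lo, wf, ?_, fun γ ↦ le_antisymm ?_ ?_⟩
  · set N := ⨆ γ : c.Cells, LinearMap.range γ.ι.hom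
    have h : ModuleCat.ofHom N.mkQ = 0 := by
      apply c.hom_ext
      · rw [hf]; simp
      · intro γ
        rw [comp_zero]
        ext x
        exact (Submodule.Quotient.mk_eq_zero _).2 (Submodule.mem_iSup_of_mem γ ⟨x, rfl⟩)
    rw [← N.ker_mkQ]
    exact LinearMap.ker_eq_top.2 (congrArg ModuleCat.Hom.hom h)
  · obtain ⟨j, hj, k⟩ := γ
    obtain ⟨ρ, hρ, hρ', hρk⟩ := exists_cell_projection (c.attachCells j hj) k
    have hle : partialSum (fun γ : c.Cells ↦ LinearMap.range γ.ι.hom) (Set.Iio ⟨j, hj, k⟩) ≤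
        (LinearMap.ker ρ.hom).map (c.incl.app (Order.succ j)).hom := by
      refine partialSum_le ?_
      rintro ⟨j', hj', k'⟩ hlt
      rintro _ ⟨x, rfl⟩
      obtain h | h := (hmono (le_of_lt hlt)).eq_or_lt
      · dsimp only at h
        subst h
        have hk : k' ≠ k := by
          rintro rfl
          exact lt_irrefl _ hlt
        exact ⟨((c.attachCells j' hj').cell k').hom x,
          LinearMap.congr_fun (congrArg ModuleCat.Hom.hom (hρ' k' hk)) x, rfl⟩
      · dsimp only at h
        let y := (c.F.map (homOfLE (Order.succ_le_of_lt h))).hom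
          (((c.attachCells j' hj').cell k').hom x)
        refine ⟨(c.F.map (homOfLE (Order.le_succ j))).hom y,
          LinearMap.congr_fun (congrArg ModuleCat.Hom.hom hρ) y, ?_⟩
        have hw : c.F.map (homOfLE (Order.succ_le_of_lt h)) ≫
            c.F.map (homOfLE (Order.le_succ j)) ≫ c.incl.app (Order.succ j) =
              c.incl.app (Order.succ j') := by simp
        exact LinearMap.congr_fun (congrArg ModuleCat.Hom.hom hw)
          (((c.attachCells j' hj').cell k').hom x)
    intro x hx
    obtain ⟨y, hy, hyx⟩ := hle hx
    have := mono_incl_app c (Order.succ j)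
    have hinj := (ModuleCat.mono_iff_injective _).1 this
    have hyx' : y = ((c.attachCells j hj).cell k).hom x := hinj hyx
    rw [hyx'] at hy
    have hx0 := LinearMap.congr_fun (congrArg ModuleCat.Hom.hom hρk) x
    exact (Submodule.Quotient.mk_eq_zero _).1 (hx0.symm.trans hy)
  · set N := partialSum (fun γ : c.Cells ↦ LinearMap.range γ.ι.hom) (Set.Iio γ)
    have h0 := incl_app_comp_eq_zero c hf (ModuleCat.ofHom N.mkQ) γ.j fun γ' hγ' ↦ by
      ext x
      refine (Submodule.Quotient.mk_eq_zero _).2 (mem_partialSum (i := γ') ⟨x, rfl⟩ ?_)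
      by_contra hnot
      exact hγ'.not_ge (hmono (not_lt.1 hnot))
    let a := c.attachCells γ.j γ.hj
    have hw : g (a.π γ.k) ≫ a.cell γ.k =
        (a.cofan₁.inj γ.k ≫ a.g₁) ≫ c.F.map (homOfLE (Order.le_succ γ.j)) := by
      rw [AttachCells.cell_def, ← a.hm_assoc, Category.assoc, a.isPushout.w]
    have hw' : c.F.map (homOfLE (Order.le_succ γ.j)) ≫ c.incl.app (Order.succ γ.j) =
        c.incl.app γ.j := by simp
    rintro _ ⟨x, rfl⟩
    have h1 := LinearMap.congr_fun (congrArg ModuleCat.Hom.hom hw) x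
    have h2 := LinearMap.congr_fun (congrArg ModuleCat.Hom.hom hw')
      ((a.cofan₁.inj γ.k ≫ a.g₁).hom x)
    have h3 := LinearMap.congr_fun (congrArg ModuleCat.Hom.hom h0)
      ((a.cofan₁.inj γ.k ≫ a.g₁).hom x)
    have h4 : γ.ι.hom ((g γ.i).hom x) =
        (c.incl.app γ.j).hom ((a.cofan₁.inj γ.k ≫ a.g₁).hom x) :=
      (congrArg (c.incl.app (Order.succ γ.j)).hom h1).trans h2
    rw [Submodule.mem_comap, h4]
    exact (Submodule.Quotient.mk_eq_zero _).1 h3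

/-- A single monomorphism of modules permits the small object argument. -/
theorem hasSmallObjectArgument_ofHoms {Q P : ModuleCat.{u} R} (g : Q ⟶ P) [Mono g] :
    HasSmallObjectArgument.{u} (ofHoms fun _ : PUnit.{u + 1} ↦ g) := by
  -- Transition maps are monomorphisms, so a regular cardinal exceeding the number of subobjects of
  -- `Q` suffices for `Hom(Q, -)` to preserve the transfinite colimits.
  obtain ⟨κ, hκ', hκ⟩ := HasCardinalLT.exists_regular_cardinal.{u} (Subobject Q)
  have : Fact κ.IsRegular := ⟨hκ'⟩
  have : Nonempty κ.ord.ToType := by simpa using hκ'.ne_zero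
  have := WellFoundedLT.toOrderBot κ.ord.ToType
  refine ⟨κ, inferInstance, inferInstance,
    { preservesColimit := fun {A B X Y} i hi f hf ↦ ?_ }⟩
  let hf' : (monomorphisms (ModuleCat.{u} R)).TransfiniteCompositionOfShape κ.ord.ToType f :=
    { toTransfiniteCompositionOfShape := hf.toTransfiniteCompositionOfShape
      map_mem j hj := by
        have h := (hf.attachCells j hj).pushouts_coproducts
        rw [ofHoms_homFamily] at h
        refine (?_ : _ ≤ monomorphisms (ModuleCat.{u} R)) _ h
        rw [pushouts_le_iff, coproducts_le_iff]
        rintro _ _ _ ⟨a⟩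
        exact inferInstanceAs (Mono g) }
  have (j j' : κ.ord.ToType) (φ : j ⟶ j') : Mono (hf'.F.map φ) := hf'.mem_map φ
  obtain ⟨⟩ := hi
  exact IsGrothendieckAbelian.preservesColimit_coyoneda_obj_of_mono (Y := hf'.F) (κ := κ) hκ

theorem exists_cellular_cover {Q P : ModuleCat.{u} R} (g : Q ⟶ P) [Mono g] (M : ModuleCat.{u} R) :
    ∃ (X : ModuleCat.{u} R) (p : X ⟶ M), HasLiftingProperty g p ∧
      ∃ (ι : Type u) (_ : LinearOrder ι) (_ : WellFoundedLT ι) (A : ι → Submodule R X),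
        ⨆ i, A i = ⊤ ∧ (∀ i, Cardinal.mk (A i) ≤ Cardinal.mk P) ∧
        ∀ i, Nonempty ((A i ⧸ (partialSum A (Set.Iio i)).submoduleOf (A i)) ≃ₗ[R]
          P ⧸ LinearMap.range g.hom) := by
  let I : MorphismProperty (ModuleCat.{u} R) := ofHoms fun _ : PUnit.{u + 1} ↦ g
  have : HasSmallObjectArgument.{u} I := hasSmallObjectArgument_ofHoms g
  let z : ModuleCat.of R PUnit.{u + 1} ⟶ M := 0
  have hz : IsZero (ModuleCat.of R PUnit.{u + 1}) := ModuleCat.isZero_of_subsingleton _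
  have : Fact I.smallObjectκ.IsRegular := smallObjectκ_isRegular I
  refine ⟨SmallObject.obj I I.smallObjectκ z, SmallObject.πObj I I.smallObjectκ z,
    SmallObject.rlp_πObj I I.smallObjectκ z _ ⟨PUnit.unit⟩, ?_⟩
  let c := SmallObject.relativeCellComplexιObj I I.smallObjectκ z
  have : ∀ a, Mono (I.homFamily a) := by
    rintro ⟨a, ⟨⟩⟩
    assumption
  obtain ⟨lo, wf, htop, hcomap⟩ := exists_order_cells c (hz.eq_of_src _ _)
  refine ⟨_, lo, wf, _, htop, fun γ ↦ ?_, fun γ ↦ ?_⟩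
  · have h : Cardinal.mk (γ.i.1.right : ModuleCat.{u} R) ≤ Cardinal.mk P := by
      obtain ⟨_, ⟨⟩⟩ := γ.i
      exact le_rfl
    exact (Cardinal.mk_le_of_surjective γ.ι.hom.surjective_rangeRestrict).trans h
  · set N := partialSum (fun γ : c.Cells ↦ LinearMap.range γ.ι.hom) (Set.Iio γ)
    have h : Nonempty ((γ.i.1.right ⧸ LinearMap.range (I.homFamily γ.i).hom) ≃ₗ[R]
        P ⧸ LinearMap.range g.hom) := by
      obtain ⟨_, ⟨⟩⟩ := γ.i
      exact ⟨LinearEquiv.refl _ _⟩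
    obtain ⟨e⟩ := h
    let q := (N.submoduleOf (LinearMap.range γ.ι.hom)).mkQ ∘ₗ γ.ι.hom.rangeRestrict
    have hker : LinearMap.ker q = LinearMap.range (I.homFamily γ.i).hom := by
      rw [← hcomap γ]
      ext x
      exact Submodule.Quotient.mk_eq_zero _
    have hsurj : Function.Surjective q :=
      (Submodule.mkQ_surjective _).comp γ.ι.hom.surjective_rangeRestrict
    exact ⟨((Submodule.quotEquivOfEq _ _ hker.symm).trans
      (LinearMap.quotKerEquivOfSurjective q hsurj)).symm.trans e⟩

end CellComplex

/-! ### Factorization classes and orthogonal classes. -/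

theorem mem_factorizationClass_iff {Q P B : ModuleCat.{u} R} {f : Q ⟶ P} :
    B ∈ factorizationClass f ↔ ∀ g : Q →ₗ[R] B, ∃ k : P →ₗ[R] B, k ∘ₗ f.hom = g := by
  constructor
  · intro h g
    obtain ⟨k, hk⟩ := h (ModuleCat.ofHom g)
    exact ⟨k.hom, congrArg ModuleCat.Hom.hom hk⟩
  · intro h g
    obtain ⟨k, hk⟩ := h g.hom
    exact ⟨ModuleCat.ofHom k, ModuleCat.hom_ext hk⟩

theorem mem_factorizationClass_iff_extVanishes {Q P B : ModuleCat.{u} R} {f : Q ⟶ P} [Mono f]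
    [Module.Projective R P] :
    B ∈ factorizationClass f ↔ ExtVanishes (P ⧸ LinearMap.range f.hom) B := by
  have hinj : Function.Injective f.hom := (ModuleCat.mono_iff_injective f).1 inferInstance
  have hex : Function.Exact f.hom (LinearMap.range f.hom).mkQ :=
    LinearMap.exact_map_mkQ_range f.hom
  rw [mem_factorizationClass_iff]
  exact ⟨ExtVanishes.of_exists_extension hinj (Submodule.mkQ_surjective _) hex,
    fun h ↦ h.exists_extension hinj (Submodule.mkQ_surjective _) hex⟩

/-- Maps out of a direct sum are families of maps, so extension along the direct sum of the `φ i` is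
extension along each of them separately. -/
theorem exists_factorizationClass_eq_iInter {ι : Type u} {K F : ι → ModuleCat.{u} R}
    (φ : ∀ i, K i ⟶ F i) [∀ i, Mono (φ i)] [∀ i, Module.Projective R (F i)] :
    ∃ (Q P : ModuleCat.{u} R) (f : Q ⟶ P), Mono f ∧ Module.Projective R P ∧
      factorizationClass f = ⋂ i, factorizationClass (φ i) := by
  classical
  let f : (⨁ i, K i) →ₗ[R] (⨁ i, F i) := DirectSum.lmap fun i ↦ (φ i).hom
  refine ⟨ModuleCat.of R (⨁ i, K i), ModuleCat.of R (⨁ i, F i),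
    ModuleCat.ofHom f, (ModuleCat.mono_iff_injective _).2 ?_,
    inferInstanceAs (Module.Projective R (⨁ i, F i)), ?_⟩
  · exact (DirectSum.lmap_injective _).2 fun i ↦ (ModuleCat.mono_iff_injective (φ i)).1 inferInstance
  ext B
  simp only [Set.mem_iInter, mem_factorizationClass_iff]
  constructor
  · intro h i g
    obtain ⟨k, hk⟩ := h (g ∘ₗ DirectSum.component R _ (fun i ↦ K i) i)
    refine ⟨k ∘ₗ DirectSum.lof R _ (fun i ↦ F i) i, LinearMap.ext fun x ↦ ?_⟩
    have := LinearMap.congr_fun hk (DirectSum.lof R _ (fun i ↦ K i) i x)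
    change k (DirectSum.lmap (fun i ↦ (φ i).hom) (DirectSum.lof R _ _ i x)) =
      g (DirectSum.component R _ (fun i ↦ K i) i (DirectSum.lof R _ _ i x)) at this
    rw [DirectSum.lmap_lof, DirectSum.component.lof_self] at this
    exact this
  · intro h g
    choose k hk using fun i ↦ h i (g ∘ₗ DirectSum.lof R _ (fun i ↦ K i) i)
    refine ⟨DirectSum.toModule R _ _ k, DirectSum.linearMap_ext R fun i ↦ ?_⟩
    refine Eq.trans (LinearMap.ext fun x ↦ ?_) (hk i)
    change DirectSum.toModule R _ _ k
      (DirectSum.lmap (fun i ↦ (φ i).hom) (DirectSum.lof R _ _ i x)) = _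
    rw [DirectSum.lmap_lof, DirectSum.toModule_lof]
    rfl

theorem exists_presentation (S : ModuleCat.{u} R) :
    ∃ (K F : ModuleCat.{u} R) (φ : K ⟶ F), Mono φ ∧ Module.Projective R F ∧
      ∀ B, B ∈ factorizationClass φ ↔ ExtVanishes S B := by
  let π : (S →₀ R) →ₗ[R] S := Finsupp.linearCombination R id
  have hπ : Function.Surjective π := Finsupp.linearCombination_id_surjective R _
  have hinj := (LinearMap.ker π).subtype_injective
  have hex := LinearMap.exact_subtype_ker_map π
  refine ⟨ModuleCat.of R (LinearMap.ker π), ModuleCat.of R (S →₀ R),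
    ModuleCat.ofHom (LinearMap.ker π).subtype, (ModuleCat.mono_iff_injective _).2 hinj,
    inferInstanceAs (Module.Projective R (S →₀ R)), fun B ↦ ?_⟩
  rw [mem_factorizationClass_iff]
  exact ⟨ExtVanishes.of_exists_extension (X := S →₀ R) hinj hπ hex,
    fun h ↦ h.exists_extension hinj hπ hex⟩

theorem exists_factorizationClass_eq_rightPerp (𝒮 : Set (ModuleCat.{u} R)) [Small.{u} 𝒮] :
    ∃ (Q P : ModuleCat.{u} R) (f : Q ⟶ P), Mono f ∧ Module.Projective R P ∧
      factorizationClass f = rightPerp 𝒮 := by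
  choose K F φ hφ hF hB using
    fun i : Shrink.{u} 𝒮 ↦ exists_presentation ((equivShrink 𝒮).symm i).1
  obtain ⟨Q, P, f, hf, hP, heq⟩ := exists_factorizationClass_eq_iInter φ
  refine ⟨Q, P, f, hf, hP, heq.trans (Set.ext fun B ↦ ?_)⟩
  simp only [Set.mem_iInter, hB]
  refine ⟨fun h C hC ↦ ?_, fun h i ↦ h _ ((equivShrink 𝒮).symm i).2⟩
  obtain ⟨i, hi⟩ := (equivShrink 𝒮).symm.surjective ⟨C, hC⟩
  have hi' : ((equivShrink 𝒮).symm i).1 = C := congrArg Subtype.val hi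
  rw [← hi']
  exact h i

/-! ### Filtering the left class and the equivalence. -/

theorem extVanishes_of_mem_sFilt {𝒮 : Set (ModuleCat.{u} R)} {B : ModuleCat.{u} R}
    (hB : B ∈ rightPerp 𝒮) {M : ModuleCat.{u} R} (hM : M ∈ sFilt 𝒮) : ExtVanishes M B := by
  obtain ⟨X, hX, P, P', hPP', ⟨e⟩⟩ := hM
  have hP : ExtVanishes P B := (extVanishes_of_mem_Filt hB hX).of_retract P.subtype
    (P.projectionOnto P' hPP') (Submodule.projectionOnto_apply_left hPP')
  exact hP.of_equiv e

theorem Filt_subset_sFilt (𝒮 : Set (ModuleCat.{u} R)) : Filt 𝒮 ⊆ sFilt 𝒮 := fun M hM ↦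
  ⟨M, hM, ⊤, ⊥, isCompl_top_bot, ⟨Submodule.topEquiv.symm⟩⟩

/-- A surjection of modules with `Ext¹(M, ker p) = 0` splits. -/
theorem exists_section {X M : ModuleCat.{u} R} {p : X ⟶ M} (hp : Function.Surjective p.hom)
    (h : ExtVanishes M (ModuleCat.of R (LinearMap.ker p.hom))) :
    ∃ i : M →ₗ[R] X, ∀ m, p.hom (i m) = m := by
  obtain ⟨r, hr⟩ := h.exists_extension (LinearMap.ker p.hom).subtype_injective hp
    (LinearMap.exact_subtype_ker_map _) LinearMap.id
  -- The retraction `r` onto the kernel gives the complementary idempotent `1 - r`, which kills `ker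
  -- p` and so descends to a section on `M`.
  let s : X →ₗ[R] X := LinearMap.id - (LinearMap.ker p.hom).subtype ∘ₗ r
  have hs : LinearMap.ker p.hom ≤ LinearMap.ker s := fun x hx ↦ by
    have : r x = ⟨x, hx⟩ := LinearMap.congr_fun hr ⟨x, hx⟩
    simp [s, this]
  refine ⟨(LinearMap.ker p.hom).liftQ s hs ∘ₗ
    (p.hom.quotKerEquivOfSurjective hp).symm.toLinearMap, fun m ↦ ?_⟩
  obtain ⟨x, rfl⟩ := hp m
  have : (p.hom.quotKerEquivOfSurjective hp).symm (p.hom x) = Submodule.Quotient.mk x := by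
    rw [LinearEquiv.symm_apply_eq]
    rfl
  simp [this, s]

/-- Representatives of the modules in `𝒜` which are quotients of the free module on `T`. -/
def quotientsOfFree (𝒜 : Set (ModuleCat.{u} R)) (T : Type u) : Set (ModuleCat.{u} R) :=
  Set.range (fun L : Submodule R (T →₀ R) ↦ ModuleCat.of R ((T →₀ R) ⧸ L)) ∩ 𝒜

instance (𝒜 : Set (ModuleCat.{u} R)) (T : Type u) : Small.{u} (quotientsOfFree 𝒜 T) :=
  small_subset Set.inter_subset_left

theorem exists_equiv_mem_quotientsOfFree {ℬ : Set (ModuleCat.{u} R)} {T : Type u}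
    {C : Type u} [AddCommGroup C] [Module R C] (hC : ∀ B ∈ ℬ, ExtVanishes C B)
    (hcard : Cardinal.mk C ≤ Cardinal.mk T) :
    ∃ S ∈ quotientsOfFree (leftPerp ℬ) T, Nonempty (C ≃ₗ[R] S) := by
  obtain ⟨j⟩ := hcard
  -- Generators outside the range of `j` go to an arbitrary element; surjectivity only uses those in
  -- the range.
  let q : (T →₀ R) →ₗ[R] C := Finsupp.linearCombination R (Function.invFun j)
  have hq : Function.Surjective q := fun c ↦
    ⟨Finsupp.single (j c) 1, by simp [q, Function.leftInverse_invFun j.injective c]⟩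
  let e := q.quotKerEquivOfSurjective hq
  exact ⟨_, ⟨⟨LinearMap.ker q, rfl⟩, fun B hB ↦ (hC B hB).of_equiv e⟩, ⟨e.symm⟩⟩

theorem mem_Filt_quotientsOfFree {Q P : ModuleCat.{u} R} (f : Q ⟶ P) [Mono f]
    [Module.Projective R P] (M : ModuleCat.{u} R)
    (hM : ∀ B ∈ factorizationClass f, ExtVanishes M B) :
    M ∈ Filt (quotientsOfFree (leftPerp (factorizationClass f))
      (max Cardinal.aleph0 (Cardinal.mk (P × R))).out) := by
  set κ := max Cardinal.aleph0 (Cardinal.mk (P × R))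
  have hf : Function.Injective f.hom := (ModuleCat.mono_iff_injective f).1 inferInstance
  -- The extra summand `R` leaves the extension property unchanged but makes maps with the lifting
  -- property surjective: the zero map on `Q` is compatible with any choice of image for the
  -- generator of `R`.
  let g : Q ⟶ ModuleCat.of R (P × R) := ModuleCat.ofHom (LinearMap.inl R P R ∘ₗ f.hom)
  have : Mono g := (ModuleCat.mono_iff_injective g).2 (LinearMap.inl_injective.comp hf)
  have : Module.Projective R (ModuleCat.of R (P × R)) :=
    inferInstanceAs (Module.Projective R (P × R))
  have hg : ∀ B ∈ factorizationClass f, ExtVanishes ((P × R) ⧸ LinearMap.range g.hom) B := by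
    intro B hB
    refine (mem_factorizationClass_iff_extVanishes (f := g)).1
      (mem_factorizationClass_iff.2 fun u ↦ ?_)
    obtain ⟨k, hk⟩ := mem_factorizationClass_iff.1 hB u
    exact ⟨k ∘ₗ LinearMap.fst R P R, hk⟩
  obtain ⟨X, p, hlift, ι, _, _, A, htop, hcard, hiso⟩ := exists_cellular_cover g M
  have hp : Function.Surjective p.hom := by
    intro m
    let v : ModuleCat.of R (P × R) ⟶ M :=
      ModuleCat.ofHom (LinearMap.toSpanSingleton R M m ∘ₗ LinearMap.snd R P R)
    have sq : CommSq (0 : Q ⟶ X) g p v := ⟨by ext x; simp [g, v]⟩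
    refine ⟨sq.lift.hom (0, 1), ?_⟩
    have := LinearMap.congr_fun (congrArg ModuleCat.Hom.hom sq.fac_right) (0, 1)
    refine this.trans ?_
    simp [v]
  have hker : ModuleCat.of R (LinearMap.ker p.hom) ∈ factorizationClass f := by
    refine mem_factorizationClass_iff.2 fun u ↦ ?_
    have sq : CommSq (ModuleCat.ofHom ((LinearMap.ker p.hom).subtype ∘ₗ u)) g p 0 :=
      -- With zero as the bottom map, the lift takes values in `ker p`; restricted to `P`, it
      -- extends `u`.
      ⟨by ext x; simp⟩
    have hl : ∀ y, p.hom (sq.lift.hom y) = 0 :=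
      LinearMap.congr_fun (congrArg ModuleCat.Hom.hom sq.fac_right)
    refine ⟨(sq.lift.hom.codRestrict _ hl) ∘ₗ LinearMap.inl R P R, LinearMap.ext fun x ↦ ?_⟩
    exact Subtype.ext (LinearMap.congr_fun (congrArg ModuleCat.Hom.hom sq.fac_left) x)
  obtain ⟨i, hi⟩ := exists_section hp (hM _ hker)
  have hκ : Cardinal.aleph0 ≤ κ := le_max_left _ _
  have hHill := isHillFamily_image_partialSum (ℬ := factorizationClass f) hκ
    (fun i ↦ (hcard i).trans (le_max_right _ _)) htop
    (fun B hB i ↦ (hg B hB).of_equiv (hiso i).some)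
  have hstep := hHill.isStepFamily_summand hκ i p.hom hi
  refine IsStepFamily.mem_Filt ⟨hstep.sSup_mem, fun N hN hne ↦ ?_⟩
    ⟨⊥, by simpa using hHill.sSup_mem ∅ (Set.empty_subset _), by simp, by simp⟩
  obtain ⟨N', hN', hlt, hle, hext⟩ := hstep.step N hN hne
  exact ⟨N', hN', hlt, exists_equiv_mem_quotientsOfFree hext (by rwa [Cardinal.mk_out])⟩

theorem tfae_isDeconstructible {𝒜 ℬ : Set (ModuleCat.{u} R)} (h : IsCotorsionPair 𝒜 ℬ) :
    List.TFAE [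
      ∃ 𝒮 : Set (ModuleCat.{u} R), Small.{u} 𝒮 ∧ ℬ = rightPerp 𝒮,
      ∃ 𝒮 : Set (ModuleCat.{u} R), Small.{u} 𝒮 ∧ 𝒮 ⊆ 𝒜 ∧ 𝒜 = sFilt 𝒮,
      IsDeconstructible 𝒜,
      ∃ (Q P : ModuleCat.{u} R) (f : Q ⟶ P), CategoryTheory.Mono f ∧
        Module.Projective R P ∧ ℬ = factorizationClass f] := by
  have hperp : ∀ 𝒮 ⊆ 𝒜, ℬ ⊆ rightPerp 𝒮 := fun 𝒮 h𝒮 B hB C hC ↦ by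
    rw [h.right_eq] at hB
    exact hB C (h𝒮 hC)
  have hmem : ∀ M : ModuleCat.{u} R, (∀ B ∈ ℬ, ExtVanishes M B) → M ∈ 𝒜 := fun M hM ↦ h.left_eq ▸ hM
  tfae_have 1 → 4
  | ⟨𝒮, h𝒮, hℬ⟩ => by
    obtain ⟨Q, P, f, hf, hP, heq⟩ := exists_factorizationClass_eq_rightPerp 𝒮
    exact ⟨Q, P, f, hf, hP, hℬ.trans heq.symm⟩
  tfae_have 4 → 3
  | ⟨Q, P, f, hf, hP, hℬ⟩ => by
    refine ⟨quotientsOfFree 𝒜 (max Cardinal.aleph0 (Cardinal.mk (P × R))).out, inferInstance,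
      Set.inter_subset_right, Set.Subset.antisymm (fun M hM ↦ ?_) fun M hM ↦ ?_⟩
    · rw [h.left_eq] at hM ⊢
      subst hℬ
      exact mem_Filt_quotientsOfFree f M hM
    · exact hmem M fun B hB ↦
        extVanishes_of_mem_Filt (hperp _ Set.inter_subset_right hB) hM
  tfae_have 3 → 2
  | ⟨𝒮, h𝒮, hsub, heq⟩ =>
    ⟨𝒮, h𝒮, hsub, Set.Subset.antisymm (heq.subset.trans (Filt_subset_sFilt 𝒮)) fun M hM ↦
      hmem M fun _ hB ↦ extVanishes_of_mem_sFilt (hperp 𝒮 hsub hB) hM⟩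
  tfae_have 2 → 1
  | ⟨𝒮, h𝒮, hsub, heq⟩ => by
    refine ⟨𝒮, h𝒮, Set.Subset.antisymm (hperp 𝒮 hsub) fun B hB ↦ ?_⟩
    rw [h.right_eq]
    intro C hC
    rw [heq] at hC
    exact extVanishes_of_mem_sFilt hB hC
  tfae_finish

end CotorsionPair

/-- Right `R`-modules are modules over the opposite ring `Rᵐᵒᵖ`. -/
theorem lemma1p1 (R : Type u) [Ring R] (𝒜 ℬ : Set (ModuleCat.{u} Rᵐᵒᵖ))
    (h : IsCotorsionPair 𝒜 ℬ) :
    List.TFAE [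
      ∃ 𝒮 : Set (ModuleCat.{u} Rᵐᵒᵖ), Small.{u} 𝒮 ∧ ℬ = rightPerp 𝒮,
      ∃ 𝒮 : Set (ModuleCat.{u} Rᵐᵒᵖ), Small.{u} 𝒮 ∧ 𝒮 ⊆ 𝒜 ∧ 𝒜 = sFilt 𝒮,
      IsDeconstructible 𝒜,
      ∃ (Q P : ModuleCat.{u} Rᵐᵒᵖ) (f : Q ⟶ P), CategoryTheory.Mono f ∧
        Module.Projective Rᵐᵒᵖ P ∧ ℬ = factorizationClass f] :=
  CotorsionPair.tfae_isDeconstructible h
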